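/- For a matrix algebra $\mathbb{B}(H)$ over a finite-dimensional nonzero complex Hilbert space $H$, a density operator is a positive semidefinite operator of trace one, and its von Neumann entropy is $H(\rho)=-\mathrm{tr}(\rho\log\rho)$. For a density operator $\rho_{MC}$ on $H_M\otimes H_C$ let $\rho_C=(\mathrm{tr}_M\otimes\mathrm{id}_C)(\rho_{MC})$ and $H(M|C)_\rho=H(\rho_{MC})-H(\rho_C)$. A quantum channel is a completely positive trace-preserving linear map. For quantum channels $\Phi_A:\mathbb{B}(H_M)\to\mathbb{B}(H_A)$ and $\Phi_B:\mathbb{B}(H_M)\to\mathbb{B}(H_B)$ with common input space, define the minimal uncertainty \[ I^{sq}(\Phi_A,\Phi_B)=\inf_{H_C}\ \inf_{\rho_{MC}}\Big(H(A|C)_{(\Phi_A\otimes\mathrm{id}_C)(\rho)}+H(B|C)_{(\Phi_B\otimes\mathrm{id}_C)(\rho)}-H(M|C)_\rho\Big), \] where the infimum runs over memory spaces $H_C$ of all finite dimensions and all density operators $\rho_{MC}$ on $H_M\otimes H_C$. Theorem. $I^{sq}$ is additive: for any two pairs of quantum channels $\Phi_A:\mathbb{B}(H_{M_1})\to\mathbb{B}(H_{A_1})$,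 $\Phi_B:\mathbb{B}(H_{M_1})\to\mathbb{B}(H_{B_1})$ and $\Psi_A:\mathbb{B}(H_{M_2})\to\mathbb{B}(H_{A_2})$, $\Psi_B:\mathbb{B}(H_{M_2})\to\mathbb{B}(H_{B_2})$ between finite-dimensional matrix algebras, \[ I^{sq}(\Phi_A\otimes\Psi_A,\Phi_B\otimes\Psi_B)=I^{sq}(\Phi_A,\Phi_B)+I^{sq}(\Psi_A,\Psi_B). \] -/

import Mathlib

namespace SquashedUncertainty

open scoped Kronecker ComplexOrder

/-- The tensor product `Φ ⊗ Ψ` of linear maps between matrix algebras, where `M_m ⊗ M_n` is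
identified with the matrices indexed by `m × n`. It is the unique linear map sending
`x ⊗ₖ y` to `Φ x ⊗ₖ Ψ y`, see `kronMap_kronecker` and `kronMap_unique`. -/
def kronMap {m n a b : Type*}
    (Φ : Matrix m m ℂ →ₗ[ℂ] Matrix a a ℂ) (Ψ : Matrix n n ℂ →ₗ[ℂ] Matrix b b ℂ) :
    Matrix (m × n) (m × n) ℂ →ₗ[ℂ] Matrix (a × b) (a × b) ℂ where
  toFun X := Matrix.of fun s t =>
    Φ (Matrix.of fun p p' => Ψ (Matrix.of fun q q' => X (p, q) (p', q')) s.2 t.2) s.1 t.1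
  map_add' X Y := by
    ext s t
    have h1 : ∀ p p', (Matrix.of fun q q' => (X + Y) (p, q) (p', q')) =
        (Matrix.of fun q q' => X (p, q) (p', q')) + Matrix.of fun q q' => Y (p, q) (p', q') :=
      fun _ _ => rfl
    have h2 : (Matrix.of fun p p' => Ψ (Matrix.of fun q q' => (X + Y) (p, q) (p', q')) s.2 t.2) =
        (Matrix.of fun p p' => Ψ (Matrix.of fun q q' => X (p, q) (p', q')) s.2 t.2) +
        Matrix.of fun p p' => Ψ (Matrix.of fun q q' => Y (p, q) (p', q')) s.2 t.2 := by
      ext p p'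
      rw [Matrix.of_apply, h1, map_add]
      rfl
    rw [Matrix.of_apply, h2, map_add]
    rfl
  map_smul' c X := by
    ext s t
    have h1 : ∀ p p', (Matrix.of fun q q' => (c • X) (p, q) (p', q')) =
        c • (Matrix.of fun q q' => X (p, q) (p', q')) := fun _ _ => rfl
    have h2 : (Matrix.of fun p p' => Ψ (Matrix.of fun q q' => (c • X) (p, q) (p', q')) s.2 t.2) =
        c • (Matrix.of fun p p' => Ψ (Matrix.of fun q q' => X (p, q) (p', q')) s.2 t.2) := by
      ext p p'
      rw [Matrix.of_apply, h1, map_smul]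
      rfl
    rw [Matrix.of_apply, h2, map_smul]
    rfl

theorem kronMap_kronecker {m n a b : Type*}
    (Φ : Matrix m m ℂ →ₗ[ℂ] Matrix a a ℂ) (Ψ : Matrix n n ℂ →ₗ[ℂ] Matrix b b ℂ)
    (x : Matrix m m ℂ) (y : Matrix n n ℂ) :
    kronMap Φ Ψ (x ⊗ₖ y) = Φ x ⊗ₖ Ψ y := by
  ext s t
  have h1 : ∀ p p', (Matrix.of fun q q' => (x ⊗ₖ y) (p, q) (p', q')) = x p p' • y :=
    fun _ _ => rfl
  have h2 : (Matrix.of fun p p' => Ψ (Matrix.of fun q q' => (x ⊗ₖ y) (p, q) (p', q')) s.2 t.2) =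
      Ψ y s.2 t.2 • x := by
    ext p p'
    simp only [Matrix.of_apply, h1, map_smul, Matrix.smul_apply, smul_eq_mul, mul_comm]
  change Φ (Matrix.of fun p p' => Ψ (Matrix.of fun q q' => (x ⊗ₖ y) (p, q) (p', q')) s.2 t.2)
    s.1 t.1 = Φ x s.1 t.1 * Ψ y s.2 t.2
  rw [h2, map_smul, Matrix.smul_apply, smul_eq_mul, mul_comm]

theorem kronMap_unique {m n a b : Type*} [Finite m] [Finite n]
    (Φ : Matrix m m ℂ →ₗ[ℂ] Matrix a a ℂ) (Ψ : Matrix n n ℂ →ₗ[ℂ] Matrix b b ℂ)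
    (T : Matrix (m × n) (m × n) ℂ →ₗ[ℂ] Matrix (a × b) (a × b) ℂ)
    (hT : ∀ x y, T (x ⊗ₖ y) = Φ x ⊗ₖ Ψ y) : T = kronMap Φ Ψ := by
  classical
  apply Matrix.ext_linearMap ℂ
  rintro ⟨i, j⟩ ⟨i', j'⟩
  apply LinearMap.ext
  intro c
  have h : Matrix.single (i, j) (i', j') c =
      (Matrix.single i i' c) ⊗ₖ (Matrix.single j j' (1 : ℂ)) := by
    rw [Matrix.single_kronecker_single, mul_one]
  simp only [LinearMap.comp_apply, Matrix.singleLinearMap_apply, h, hT, kronMap_kronecker]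

/-- Density operators: positive semidefinite of trace one. -/
def IsDensity {n : Type*} [Fintype n] (ρ : Matrix n n ℂ) : Prop :=
  ρ.PosSemidef ∧ ρ.trace = 1

/-- Quantum channels: completely positive trace preserving maps. -/
structure IsChannel {m a : Type*} [Fintype m] [Fintype a]
    (Φ : Matrix m m ℂ →ₗ[ℂ] Matrix a a ℂ) : Prop where
  completelyPositive : ∀ (n : ℕ) (X : Matrix (m × Fin n) (m × Fin n) ℂ), X.PosSemidef →
    (kronMap Φ (LinearMap.id : Matrix (Fin n) (Fin n) ℂ →ₗ[ℂ] Matrix (Fin n) (Fin n) ℂ)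
      X).PosSemidef
  tracePreserving : ∀ x : Matrix m m ℂ, (Φ x).trace = x.trace

/-- The von Neumann entropy `H(ρ) = -tr(ρ log ρ)`, with natural logarithm; `log` is applied by
functional calculus, and `0 log 0 = 0` because `Real.log 0 = 0`. -/
noncomputable def entropy {n : Type*} [Fintype n] [DecidableEq n] (ρ : Matrix n n ℂ) : ℝ :=
  -(ρ * cfc Real.log ρ).trace.re

/-- The reduced operator `ρ_C = (tr_M ⊗ id_C)(ρ_MC)`. -/
def reduced {m c : Type*} [Fintype m] (ρ : Matrix (m × c) (m × c) ℂ) : Matrix c c ℂ :=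
  Matrix.of fun k l => ∑ i, ρ (i, k) (i, l)

/-- The conditional entropy `H(M|C)_ρ = H(ρ_MC) - H(ρ_C)`. -/
noncomputable def condEntropy {m c : Type*} [Fintype m] [Fintype c] [DecidableEq m]
    [DecidableEq c] (ρ : Matrix (m × c) (m × c) ℂ) : ℝ :=
  entropy ρ - entropy (reduced ρ)

/-- The generalized conditional mutual information
`I(Φ_A, Φ_B | C)_ρ = H(A|C) + H(B|C) - H(M|C)`, the first two terms being evaluated at
`(Φ_A ⊗ id_C)(ρ)` and `(Φ_B ⊗ id_C)(ρ)`. -/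
noncomputable def condInfo {m a b c : Type*} [Fintype m] [Fintype a] [Fintype b] [Fintype c]
    [DecidableEq m] [DecidableEq a] [DecidableEq b] [DecidableEq c]
    (ΦA : Matrix m m ℂ →ₗ[ℂ] Matrix a a ℂ) (ΦB : Matrix m m ℂ →ₗ[ℂ] Matrix b b ℂ)
    (ρ : Matrix (m × c) (m × c) ℂ) : ℝ :=
  condEntropy (kronMap ΦA (LinearMap.id : Matrix c c ℂ →ₗ[ℂ] Matrix c c ℂ) ρ)
    + condEntropy (kronMap ΦB (LinearMap.id : Matrix c c ℂ →ₗ[ℂ] Matrix c c ℂ) ρ)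
    - condEntropy ρ

/-- `I(Φ_A, Φ_B | C)`: the infimum over all states `ρ_MC`, for a fixed memory system `C`. The
infimum is taken in the extended reals, so that it is a genuine infimum. -/
noncomputable def minUncertaintyWith {m a b : Type*} [Fintype m] [Fintype a] [Fintype b]
    [DecidableEq m] [DecidableEq a] [DecidableEq b] (c : Type*) [Fintype c] [DecidableEq c]
    (ΦA : Matrix m m ℂ →ₗ[ℂ] Matrix a a ℂ) (ΦB : Matrix m m ℂ →ₗ[ℂ] Matrix b b ℂ) : EReal :=
  ⨅ ρ : {ρ : Matrix (m × c) (m × c) ℂ // IsDensity ρ}, (condInfo ΦA ΦB ρ.1 : EReal)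

/-- `I^sq(Φ_A, Φ_B)`: the infimum over memory systems of all finite dimensions. -/
noncomputable def minUncertainty {m a b : Type*} [Fintype m] [Fintype a] [Fintype b]
    [DecidableEq m] [DecidableEq a] [DecidableEq b]
    (ΦA : Matrix m m ℂ →ₗ[ℂ] Matrix a a ℂ) (ΦB : Matrix m m ℂ →ₗ[ℂ] Matrix b b ℂ) : EReal :=
  ⨅ d : ℕ, minUncertaintyWith (Fin d) ΦA ΦB

end SquashedUncertainty

namespace SquashedUncertainty

open scoped Kronecker ComplexOrder Matrix
open Matrix Filter Topology

/-! Subadditivity comes from product states: entropy is additive on them, so near-optimal states for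
the two pairs multiply to a competitor for the tensor pair.

Superadditivity rests on the chain rule H(A₁A₂|C) = H(A₂|A₁C) + H(A₁|C), used also for B and M. Data
processing for the channel M₁ → A₁ on the memory gives H(A₂|A₁C) ≥ H(A₂|M₁C), and likewise for B,
while the M-term splits exactly. So the quantity for the tensor pair at ρ dominates that for Φ with
memory C plus that for Ψ with memory M₁C; the latter is admissible because memories of every
dimension compete (`condInfo_superadditive`).

The analytic core is data processing, `IsKraus.condEntropy_le`. Here -H(A|C) is the relative entropy
of ρ to 1 ⊗ ρ_C, and integrating p / (q + t p) over t > 0 reduces its monotonicity to that of the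
quasi-entropies `quasiEntropy`. Each of these is the maximum of a quadratic form `quasiForm`.
Pulling a test matrix back along the adjoint of the channel does not decrease the form, by a Schwarz
inequality for Kraus maps (`IsKraus.trace_conj_le`). -/

/-- `ρ = U diag(p) Uᴴ` with `U` unitary. -/
structure IsDiagonalization {n : Type*} [Fintype n] [DecidableEq n] (U : Matrix n n ℂ) (p : n → ℝ)
    (ρ : Matrix n n ℂ) : Prop where
  unitary : Uᴴ * U = 1
  eq : ρ = U * diagonal (fun i => (p i : ℂ)) * Uᴴ

/-! ### Entropy through eigenvalues; additivity on product states. -/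

section Entropy

variable {n k : Type*} [Fintype n] [DecidableEq n] [Fintype k] [DecidableEq k]

theorem IsDiagonalization.unitary' {U : Matrix n n ℂ} {p : n → ℝ} {ρ : Matrix n n ℂ}
    (h : IsDiagonalization U p ρ) : U * Uᴴ = 1 :=
  mul_eq_one_comm.mp h.unitary

theorem isDiagonalization_eigenvalues {ρ : Matrix n n ℂ} (h : ρ.IsHermitian) :
    IsDiagonalization (h.eigenvectorUnitary : Matrix n n ℂ) h.eigenvalues ρ where
  unitary := by
    rw [← star_eq_conjTranspose]
    exact Unitary.coe_star_mul_self h.eigenvectorUnitary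
  eq := by
    conv_lhs => rw [h.spectral_theorem, Unitary.conjStarAlgAut_apply]
    rfl

theorem exists_isDiagonalization {ρ : Matrix n n ℂ} (h : ρ.PosSemidef) :
    ∃ (U : Matrix n n ℂ) (p : n → ℝ), IsDiagonalization U p ρ ∧ ∀ i, 0 ≤ p i :=
  ⟨_, _, isDiagonalization_eigenvalues h.1, h.eigenvalues_nonneg⟩

theorem IsDiagonalization.isHermitian {U : Matrix n n ℂ} {p : n → ℝ} {ρ : Matrix n n ℂ}
    (h : IsDiagonalization U p ρ) : ρ.IsHermitian := by
  rw [h.eq]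
  apply isHermitian_mul_mul_conjTranspose
  rw [IsHermitian, diagonal_conjTranspose]
  congr 1
  ext i
  simp

theorem IsDiagonalization.roots_charpoly {U : Matrix n n ℂ} {p : n → ℝ} {ρ : Matrix n n ℂ}
    (h : IsDiagonalization U p ρ) :
    ρ.charpoly.roots = Finset.univ.val.map fun i => (p i : ℂ) := by
  rw [h.eq, charpoly_mul_comm, ← mul_assoc, h.unitary, one_mul, charpoly_diagonal,
    Polynomial.roots_prod]
  · simp [Multiset.bind_singleton]
  · exact Finset.prod_ne_zero_iff.mpr fun i _ => Polynomial.X_sub_C_ne_zero _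

/-- The characteristic polynomial does not depend on an eigenbasis. Hence any diagonalization
computes the entropy, and reindexing leaves it unchanged. -/
theorem entropy_eq_sum_roots {ρ : Matrix n n ℂ} (h : ρ.IsHermitian) :
    entropy ρ = (ρ.charpoly.roots.map fun z => Real.negMulLog z.re).sum := by
  have hd := isDiagonalization_eigenvalues h
  rw [hd.roots_charpoly, Multiset.map_map]
  have hlog : cfc Real.log ρ = (h.eigenvectorUnitary : Matrix n n ℂ) *
      diagonal (fun i => (Real.log (h.eigenvalues i) : ℂ)) *
        (h.eigenvectorUnitary : Matrix n n ℂ)ᴴ := by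
    rw [h.cfc_eq, IsHermitian.cfc, Unitary.conjStarAlgAut_apply]
    rfl
  have htr : (ρ * cfc Real.log ρ).trace =
      ∑ i, ((h.eigenvalues i * Real.log (h.eigenvalues i) : ℝ) : ℂ) := by
    rw [hlog]
    nth_rewrite 1 [hd.eq]
    generalize (h.eigenvectorUnitary : Matrix n n ℂ) = U at hd
    have : ∀ D E : Matrix n n ℂ, (U * D * Uᴴ * (U * E * Uᴴ)).trace = (D * E).trace := by
      intro D E
      calc (U * D * Uᴴ * (U * E * Uᴴ)).trace = (U * (D * (Uᴴ * U) * E * Uᴴ)).trace := by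
            simp only [mul_assoc]
        _ = (D * E).trace := by
            rw [hd.unitary, trace_mul_comm, mul_one, mul_assoc, hd.unitary, mul_one]
    rw [this, diagonal_mul_diagonal, trace_diagonal]
    simp
  rw [entropy, htr, ← Complex.ofReal_sum, Complex.ofReal_re, ← Finset.sum_neg_distrib]
  change _ = ∑ i, Real.negMulLog (h.eigenvalues i)
  simp [Real.negMulLog]

theorem IsDiagonalization.entropy_eq {U : Matrix n n ℂ} {p : n → ℝ} {ρ : Matrix n n ℂ}
    (h : IsDiagonalization U p ρ) : entropy ρ = ∑ i, Real.negMulLog (p i) := by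
  rw [entropy_eq_sum_roots h.isHermitian, h.roots_charpoly, Multiset.map_map]
  rfl

theorem entropy_submatrix {ρ : Matrix n n ℂ} (h : ρ.IsHermitian) (e : k ≃ n) :
    entropy (ρ.submatrix e e) = entropy ρ := by
  have : ρ.submatrix e e = reindex e.symm e.symm ρ := rfl
  rw [entropy_eq_sum_roots h, entropy_eq_sum_roots (h.submatrix e), this, charpoly_reindex]

theorem IsDiagonalization.trace_eq {U : Matrix n n ℂ} {p : n → ℝ} {ρ : Matrix n n ℂ}
    (h : IsDiagonalization U p ρ) : ρ.trace = ∑ i, (p i : ℂ) := by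
  rw [h.eq, trace_mul_comm, ← mul_assoc, h.unitary, one_mul, trace_diagonal]

theorem IsDiagonalization.kronecker {U : Matrix n n ℂ} {p : n → ℝ} {ρ : Matrix n n ℂ}
    {V : Matrix k k ℂ} {q : k → ℝ} {σ : Matrix k k ℂ}
    (h : IsDiagonalization U p ρ) (h' : IsDiagonalization V q σ) :
    IsDiagonalization (U ⊗ₖ V) (fun s => p s.1 * q s.2) (ρ ⊗ₖ σ) where
  unitary := by
    rw [conjTranspose_kronecker, ← mul_kronecker_mul, h.unitary, h'.unitary, one_kronecker_one]
  eq := by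
    rw [conjTranspose_kronecker, h.eq, h'.eq, mul_kronecker_mul, mul_kronecker_mul,
      diagonal_kronecker_diagonal]
    simp

theorem isDiagonalization_one : IsDiagonalization (1 : Matrix n n ℂ) (fun _ => 1) 1 where
  unitary := by simp
  eq := by simp

theorem entropy_kronecker {ρ : Matrix n n ℂ} {σ : Matrix k k ℂ} (hρ : IsDensity ρ)
    (hσ : IsDensity σ) : entropy (ρ ⊗ₖ σ) = entropy ρ + entropy σ := by
  obtain ⟨U, p, hU, -⟩ := exists_isDiagonalization hρ.1
  obtain ⟨V, q, hV, -⟩ := exists_isDiagonalization hσ.1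
  have hp : ∑ i, p i = 1 := by
    have := hU.trace_eq.symm.trans hρ.2
    exact_mod_cast this
  have hq : ∑ i, q i = 1 := by
    have := hV.trace_eq.symm.trans hσ.2
    exact_mod_cast this
  rw [(hU.kronecker hV).entropy_eq, hU.entropy_eq, hV.entropy_eq, Fintype.sum_prod_type]
  simp only [Real.negMulLog_mul, Finset.sum_add_distrib, ← Finset.sum_mul, ← Finset.mul_sum,
    hp, hq, one_mul]

end Entropy

/-! ### Kraus representations of channels. -/

section Kraus

theorem linearMap_apply_eq_sum {m a : Type*} [Fintype m] [DecidableEq m]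
    (Φ : Matrix m m ℂ →ₗ[ℂ] Matrix a a ℂ) (x : Matrix m m ℂ)
    (u v : a) :
    Φ x u v = ∑ i, ∑ j, x i j * Φ (Matrix.single i j 1) u v := by
  conv_lhs => rw [matrix_eq_sum_single x]
  simp only [map_sum, Matrix.sum_apply]
  refine Finset.sum_congr rfl fun i _ => Finset.sum_congr rfl fun j _ => ?_
  rw [← mul_one (x i j), ← smul_eq_mul, ← smul_single, map_smul, Matrix.smul_apply]
  simp

variable {m a n b r s : Type*} [Fintype m] [Fintype a] [Fintype n] [Fintype b] [Fintype r]
  [Fintype s] [DecidableEq m] [DecidableEq n]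

/-- `Φ(x) = ∑ᵢ Kᵢ x Kᵢᴴ` with `∑ᵢ Kᵢᴴ Kᵢ = 1`. -/
structure IsKraus (K : r → Matrix a m ℂ) (Φ : Matrix m m ℂ →ₗ[ℂ] Matrix a a ℂ) : Prop where
  apply_eq : ∀ x, Φ x = ∑ i, K i * x * (K i)ᴴ
  sum_eq_one : ∑ i, (K i)ᴴ * K i = 1

theorem isKraus_id : IsKraus (fun _ : Unit => (1 : Matrix m m ℂ)) LinearMap.id where
  apply_eq := by simp
  sum_eq_one := by simp

theorem IsKraus.trace_apply {K : r → Matrix a m ℂ}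
    {Φ : Matrix m m ℂ →ₗ[ℂ] Matrix a a ℂ} (h : IsKraus K Φ) (x : Matrix m m ℂ) :
    (Φ x).trace = x.trace := by
  rw [h.apply_eq, trace_sum]
  simp_rw [trace_mul_cycle _ x]
  rw [← trace_sum, ← Finset.sum_mul, h.sum_eq_one, one_mul]

theorem IsKraus.posSemidef {K : r → Matrix a m ℂ}
    {Φ : Matrix m m ℂ →ₗ[ℂ] Matrix a a ℂ} (h : IsKraus K Φ) {x : Matrix m m ℂ}
    (hx : x.PosSemidef) : (Φ x).PosSemidef := by
  rw [h.apply_eq]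
  exact posSemidef_sum _ fun i _ => hx.mul_mul_conjTranspose_same _

theorem IsKraus.isDensity {K : r → Matrix a m ℂ}
    {Φ : Matrix m m ℂ →ₗ[ℂ] Matrix a a ℂ} (h : IsKraus K Φ) {x : Matrix m m ℂ}
    (hx : IsDensity x) : IsDensity (Φ x) :=
  ⟨h.posSemidef hx.1, (h.trace_apply x).trans hx.2⟩

theorem IsKraus.tensor {K : r → Matrix a m ℂ} {L : s → Matrix b n ℂ}
    {Φ : Matrix m m ℂ →ₗ[ℂ] Matrix a a ℂ} {Ψ : Matrix n n ℂ →ₗ[ℂ] Matrix b b ℂ}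
    (hK : IsKraus K Φ) (hL : IsKraus L Ψ) :
    IsKraus (fun i : r × s => K i.1 ⊗ₖ L i.2) (kronMap Φ Ψ) where
  apply_eq := by
    let T : Matrix (m × n) (m × n) ℂ →ₗ[ℂ] Matrix (a × b) (a × b) ℂ :=
      { toFun := fun x => ∑ i : r × s, (K i.1 ⊗ₖ L i.2) * x * (K i.1 ⊗ₖ L i.2)ᴴ
        map_add' := fun x y => by
          simp only [Matrix.mul_add, Matrix.add_mul, Finset.sum_add_distrib]
        map_smul' := fun c x => by simp [Finset.smul_sum] }
    have hT : T = kronMap Φ Ψ := by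
      apply kronMap_unique
      intro x y
      change ∑ i : r × s, (K i.1 ⊗ₖ L i.2) * (x ⊗ₖ y) * (K i.1 ⊗ₖ L i.2)ᴴ = _
      simp only [conjTranspose_kronecker, ← mul_kronecker_mul]
      rw [hK.apply_eq, hL.apply_eq, Fintype.sum_prod_type]
      ext ⟨i, j⟩ ⟨i', j'⟩
      simp only [Matrix.sum_apply, kroneckerMap_apply, Finset.sum_mul_sum]
    intro x
    rw [← hT]
    rfl
  sum_eq_one := by
    simp only [conjTranspose_kronecker, ← mul_kronecker_mul]
    rw [← one_kronecker_one, ← hK.sum_eq_one, ← hL.sum_eq_one, Fintype.sum_prod_type]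
    ext ⟨i, j⟩ ⟨i', j'⟩
    simp only [Matrix.sum_apply, kroneckerMap_apply, Finset.sum_mul_sum]

/-- The Choi matrix of a channel is positive semidefinite. -/
theorem IsChannel.choi_posSemidef {Φ : Matrix m m ℂ →ₗ[ℂ] Matrix a a ℂ} (h : IsChannel Φ) :
    (Matrix.of fun s t : a × m => Φ (Matrix.single s.2 t.2 1) s.1 t.1).PosSemidef := by
  let e := Fintype.equivFin m
  -- The unnormalised maximally entangled vector; `e` labels the ancilla by `Fin`, as complete
  -- positivity is stated there.
  let w : m × Fin (Fintype.card m) → ℂ := fun x => if e x.1 = x.2 then 1 else 0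
  have hw := h.completelyPositive (Fintype.card m) _ (posSemidef_vecMulVec_self_star w)
  convert hw.submatrix (Prod.map id e) using 1
  ext ⟨u, i⟩ ⟨v, j⟩
  simp only [of_apply, submatrix_apply, kronMap, LinearMap.coe_mk, AddHom.coe_mk, Prod.map,
    LinearMap.id_apply, id]
  refine congrFun (congrFun (congrArg Φ (Matrix.ext fun p p' => ?_)) u) v
  simp only [Matrix.single_apply, of_apply, vecMulVec_apply, w, Pi.star_apply,
    EmbeddingLike.apply_eq_iff_eq]
  by_cases h1 : p = i <;> by_cases h2 : p' = j <;>
    simp [h1, h2, eq_comm (a := i), eq_comm (a := j)]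

/-- Eigenvectors of the Choi matrix, scaled by the square roots of their eigenvalues and reshaped
into matrices, are Kraus operators. -/
theorem IsChannel.exists_isKraus [DecidableEq a] {Φ : Matrix m m ℂ →ₗ[ℂ] Matrix a a ℂ}
    (h : IsChannel Φ) : ∃ K : a × m → Matrix a m ℂ, IsKraus K Φ := by
  obtain ⟨U, p, hU, hp⟩ := exists_isDiagonalization h.choi_posSemidef
  have hC : ∀ i j u v, Φ (Matrix.single i j 1) u v =
      ∑ r, U (u, i) r * p r * star (U (v, j) r) := by
    intro i j u v
    have := congrFun (congrFun hU.eq (u, i)) (v, j)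
    rw [of_apply] at this
    rw [this, mul_apply]
    simp [mul_diagonal]
  let K : a × m → Matrix a m ℂ := fun r => Matrix.of fun u i => (Real.sqrt (p r) : ℂ) * U (u, i) r
  have hK : ∀ x, Φ x = ∑ r, K r * x * (K r)ᴴ := by
    intro x
    ext u v
    rw [linearMap_apply_eq_sum, Matrix.sum_apply]
    simp only [mul_apply, hC, Finset.mul_sum, Finset.sum_mul, conjTranspose_apply]
    rw [Finset.sum_comm]
    conv_rhs => rw [Finset.sum_comm]
    refine Finset.sum_congr rfl fun j _ => ?_
    rw [Finset.sum_comm]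
    refine Finset.sum_congr rfl fun r _ => Finset.sum_congr rfl fun i _ => ?_
    have hs : (p r : ℂ) = (Real.sqrt (p r) : ℂ) * (Real.sqrt (p r) : ℂ) := by
      rw [← Complex.ofReal_mul, Real.mul_self_sqrt (hp r)]
    simp only [K, of_apply, star_mul', RCLike.star_def, Complex.conj_ofReal]
    rw [hs]
    ring
  refine ⟨K, hK, ?_⟩
  -- Trace preservation on the matrix unit at `(j, i)` reads off the `(i, j)` entry of `∑ Kᴴ K`.
  ext i j
  have ht := h.tracePreserving (Matrix.single j i 1)
  rw [hK, trace_sum] at ht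
  simp_rw [trace_mul_cycle _ (Matrix.single j i (1 : ℂ))] at ht
  rw [← trace_sum, ← Finset.sum_mul, trace_mul_single] at ht
  rcases eq_or_ne j i with rfl | hij
  · simpa using ht
  · simpa [hij, hij.symm, one_apply] using ht

end Kraus

/-! ### From quasi-entropies to logarithms. -/

section Limit

/-- Integrating the inequality `∑ c' p' / (q' + t p') ≤ ∑ c p / (q + t p)` over `t > 0`. -/
theorem sum_mul_log_sub_log_le {I J : Type*} [Fintype I] [Fintype J]
    {c p q : I → ℝ} {c' p' q' : J → ℝ} (hp : ∀ i, 0 ≤ p i)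
    (hc : ∀ i, c i ≠ 0 → 0 < p i ∧ 0 < q i) (hp' : ∀ i, 0 ≤ p' i)
    (hc' : ∀ i, c' i ≠ 0 → 0 < p' i ∧ 0 < q' i) (hsum : ∑ i, c i = ∑ j, c' j)
    (hle : ∀ t : ℝ, 0 < t →
      ∑ j, c' j * (p' j / (q' j + t * p' j)) ≤ ∑ i, c i * (p i / (q i + t * p i))) :
    ∑ j, c' j * (Real.log (p' j) - Real.log (q' j)) ≤
      ∑ i, c i * (Real.log (p i) - Real.log (q i)) := by
  have hder : ∀ c p q : ℝ, 0 ≤ p → (c ≠ 0 → 0 < p ∧ 0 < q) → ∀ t : ℝ, 0 ≤ t →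
      HasDerivAt (fun t => c * (Real.log (q + t * p) - Real.log q)) (c * (p / (q + t * p))) t := by
    intro c p q hp hc t ht
    by_cases h0 : c = 0
    · simpa [h0] using hasDerivAt_const t (0 : ℝ)
    · obtain ⟨-, hq⟩ := hc h0
      have h1 : HasDerivAt (fun t : ℝ => q + t * p) p t := by
        simpa using ((hasDerivAt_id t).mul_const p).const_add q
      exact ((h1.log (by positivity)).sub_const _).const_mul c
  -- The primitive diverges like `c * Real.log t`. Since both sides have the same total weight by
  -- `hsum`, subtracting this term preserves their comparison.
  have hlim : ∀ c p q : ℝ, 0 ≤ p → (c ≠ 0 → 0 < p ∧ 0 < q) →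
      Tendsto (fun t => c * (Real.log (q + t * p) - Real.log q) - c * Real.log t) atTop
        (𝓝 (c * (Real.log p - Real.log q))) := by
    intro c p q _ hc
    by_cases h0 : c = 0
    · simp [h0]
    · obtain ⟨hp, hq⟩ := hc h0
      have h1 : Tendsto (fun t : ℝ => q / t + p) atTop (𝓝 (0 + p)) :=
        (tendsto_const_nhds.div_atTop tendsto_id).add tendsto_const_nhds
      rw [zero_add] at h1
      refine (((h1.log hp.ne').sub_const (Real.log q)).const_mul c).congr' ?_
      filter_upwards [eventually_gt_atTop 0] with t ht
      have : q / t + p = (q + t * p) / t := by field_simp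
      rw [this, Real.log_div (by positivity) ht.ne']
      ring
  let G : ℝ → ℝ := fun t => ∑ i, c i * (Real.log (q i + t * p i) - Real.log (q i))
  let G' : ℝ → ℝ := fun t => ∑ j, c' j * (Real.log (q' j + t * p' j) - Real.log (q' j))
  have hG : ∀ t, 0 ≤ t → HasDerivAt (fun t => G t - G' t)
      (∑ i, c i * (p i / (q i + t * p i)) - ∑ j, c' j * (p' j / (q' j + t * p' j))) t := by
    intro t ht
    exact (HasDerivAt.fun_sum fun i _ => hder _ _ _ (hp i) (hc i) t ht).sub
      (HasDerivAt.fun_sum fun i _ => hder _ _ _ (hp' i) (hc' i) t ht)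
  have hmono : MonotoneOn (fun t => G t - G' t) (Set.Ici 0) := by
    apply monotoneOn_of_deriv_nonneg (convex_Ici 0)
    · exact fun t ht => (hG t ht).continuousAt.continuousWithinAt
    · rw [interior_Ici]
      exact fun t ht => (hG t (le_of_lt ht)).differentiableAt.differentiableWithinAt
    · rw [interior_Ici]
      intro t ht
      rw [(hG t (le_of_lt ht)).deriv]
      exact sub_nonneg.mpr (hle t ht)
  have hGG : ∀ t, 0 ≤ t → G' t ≤ G t := by
    intro t ht
    have := hmono (Set.mem_Ici.mpr le_rfl) (Set.mem_Ici.mpr ht) ht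
    have h0 : G 0 = 0 := by simp [G]
    have h0' : G' 0 = 0 := by simp [G']
    simp only [h0, h0'] at this
    linarith
  have hl := tendsto_finsetSum Finset.univ fun i _ => hlim _ _ _ (hp i) (hc i)
  have hl' := tendsto_finsetSum Finset.univ fun i _ => hlim _ _ _ (hp' i) (hc' i)
  refine le_of_tendsto_of_tendsto hl' hl ?_
  filter_upwards [eventually_ge_atTop 0] with t ht
  simp only [Finset.sum_sub_distrib, ← Finset.sum_mul, hsum]
  exact sub_le_sub_right (hGG t ht) _

end Limit

/-! ### Monotonicity of quasi-entropies under Kraus maps. -/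

section Monotonicity

variable {k l r : Type*} [Fintype k] [DecidableEq k] [Fintype l] [Fintype r]

/-- The quadratic functional `2 Re tr(Xᴴρ) - tr(XᴴσX) - t tr(XρXᴴ)`, whose supremum over `X` is the
quasi-entropy `quasiEntropy`. -/
noncomputable def quasiForm (ρ σ : Matrix k k ℂ) (t : ℝ) (X : Matrix k k ℂ) : ℝ :=
  2 * (Xᴴ * ρ).trace.re - (Xᴴ * σ * X).trace.re - t * (X * ρ * Xᴴ).trace.re

/-- `∑ᵢⱼ |⟨vⱼ, uᵢ⟩|² pᵢ² / (qⱼ + t pᵢ)` for orthonormal bases `U`, `V` and eigenvalues `p`, `q`. -/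
noncomputable def quasiEntropy (U : Matrix k k ℂ) (p : k → ℝ) (V : Matrix k k ℂ) (q : k → ℝ)
    (t : ℝ) : ℝ :=
  ∑ s : k × k, Complex.normSq ((Vᴴ * U) s.2 s.1) * p s.1 * (p s.1 / (q s.2 + t * p s.1))

variable {U V : Matrix k k ℂ} {p q : k → ℝ} {ρ σ : Matrix k k ℂ}

/-- In the eigenbases of σ (rows) and ρ (columns) the form decouples into one scalar quadratic per
matrix entry. -/
theorem quasiForm_conj (hU : IsDiagonalization U p ρ) (hV : IsDiagonalization V q σ) (t : ℝ)
    (Y : Matrix k k ℂ) :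
    quasiForm ρ σ t (V * Y * Uᴴ) = ∑ s : k × k,
      (2 * p s.1 * (star (Y s.2 s.1) * (Vᴴ * U) s.2 s.1).re
        - (q s.2 + t * p s.1) * Complex.normSq (Y s.2 s.1)) := by
  have h1 : ((V * Y * Uᴴ)ᴴ * ρ).trace =
      (Yᴴ * (Vᴴ * U) * diagonal (fun i => (p i : ℂ))).trace := by
    calc ((V * Y * Uᴴ)ᴴ * ρ).trace
        = (U * (Yᴴ * (Vᴴ * U) * diagonal (fun i => (p i : ℂ)) * Uᴴ)).trace := by
          rw [hU.eq]; simp only [conjTranspose_mul, conjTranspose_conjTranspose, mul_assoc]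
      _ = _ := by rw [trace_mul_comm, mul_assoc, hU.unitary, mul_one]
  have h2 : ((V * Y * Uᴴ)ᴴ * σ * (V * Y * Uᴴ)).trace =
      (Yᴴ * diagonal (fun i => (q i : ℂ)) * Y).trace := by
    calc ((V * Y * Uᴴ)ᴴ * σ * (V * Y * Uᴴ)).trace
        = (U * (Yᴴ * (Vᴴ * V) * diagonal (fun i => (q i : ℂ)) * (Vᴴ * V) * Y * Uᴴ)).trace := by
          rw [hV.eq]; simp only [conjTranspose_mul, conjTranspose_conjTranspose, mul_assoc]
      _ = _ := by rw [trace_mul_comm, mul_assoc, hU.unitary, hV.unitary]; simp only [mul_one]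
  have h3 : (V * Y * Uᴴ * ρ * (V * Y * Uᴴ)ᴴ).trace =
      (Y * diagonal (fun i => (p i : ℂ)) * Yᴴ).trace := by
    calc (V * Y * Uᴴ * ρ * (V * Y * Uᴴ)ᴴ).trace
        = (V * (Y * (Uᴴ * U) * diagonal (fun i => (p i : ℂ)) * (Uᴴ * U) * Yᴴ * Vᴴ)).trace := by
          rw [hU.eq]; simp only [conjTranspose_mul, conjTranspose_conjTranspose, mul_assoc]
      _ = _ := by rw [trace_mul_comm, mul_assoc, hU.unitary, hV.unitary]; simp only [mul_one]
  have e1 : ((V * Y * Uᴴ)ᴴ * ρ).trace.re =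
      ∑ s : k × k, p s.1 * (star (Y s.2 s.1) * (Vᴴ * U) s.2 s.1).re := by
    rw [h1, Fintype.sum_prod_type, Matrix.trace, Complex.re_sum]
    refine Finset.sum_congr rfl fun i _ => ?_
    rw [diag_apply, mul_diagonal, Complex.re_mul_ofReal, mul_apply, Complex.re_sum,
      Finset.sum_mul]
    refine Finset.sum_congr rfl fun j _ => ?_
    rw [conjTranspose_apply, mul_comm]
  have e2 : ((V * Y * Uᴴ)ᴴ * σ * (V * Y * Uᴴ)).trace.re =
      ∑ s : k × k, q s.2 * Complex.normSq (Y s.2 s.1) := by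
    rw [h2, Fintype.sum_prod_type, Matrix.trace, Complex.re_sum]
    refine Finset.sum_congr rfl fun i _ => ?_
    rw [diag_apply, mul_apply, Complex.re_sum]
    refine Finset.sum_congr rfl fun j _ => ?_
    rw [mul_diagonal, conjTranspose_apply, mul_right_comm, Complex.re_mul_ofReal, mul_comm,
      RCLike.star_def, mul_comm ((starRingEnd ℂ) _), Complex.mul_conj, Complex.ofReal_re]
  have e3 : (V * Y * Uᴴ * ρ * (V * Y * Uᴴ)ᴴ).trace.re =
      ∑ s : k × k, p s.1 * Complex.normSq (Y s.2 s.1) := by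
    rw [h3, Fintype.sum_prod_type, Finset.sum_comm, Matrix.trace, Complex.re_sum]
    refine Finset.sum_congr rfl fun j _ => ?_
    rw [diag_apply, mul_apply, Complex.re_sum]
    refine Finset.sum_congr rfl fun i _ => ?_
    rw [mul_diagonal, conjTranspose_apply, mul_right_comm, Complex.re_mul_ofReal, mul_comm,
      RCLike.star_def, Complex.mul_conj, Complex.ofReal_re]
  rw [quasiForm, e1, e2, e3, Finset.mul_sum, Finset.mul_sum, ← Finset.sum_sub_distrib,
    ← Finset.sum_sub_distrib]
  refine Finset.sum_congr rfl fun s _ => ?_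
  ring

/-- Completing the square entry by entry. -/
theorem quasiForm_le_quasiEntropy (hU : IsDiagonalization U p ρ) (hV : IsDiagonalization V q σ)
    (hp : ∀ i, 0 ≤ p i) (hq : ∀ i, 0 ≤ q i) {t : ℝ} (ht : 0 < t) (X : Matrix k k ℂ) :
    quasiForm ρ σ t X ≤ quasiEntropy U p V q t := by
  have hX : X = V * (Vᴴ * X * U) * Uᴴ := by
    calc X = (V * Vᴴ) * X * (U * Uᴴ) := by rw [hU.unitary', hV.unitary', one_mul, mul_one]
      _ = _ := by simp only [mul_assoc]
  rw [hX, quasiForm_conj hU hV, quasiEntropy]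
  refine Finset.sum_le_sum fun s _ => ?_
  generalize (Vᴴ * X * U) s.2 s.1 = y
  generalize (Vᴴ * U) s.2 s.1 = g
  have h1 := hp s.1
  have h2 := hq s.2
  generalize p s.1 = p at *
  generalize q s.2 = q at *
  simp only [RCLike.star_def, Complex.mul_re, Complex.conj_re, Complex.conj_im,
    Complex.normSq_apply]
  -- For `p = 0` the denominator `q + t * p` may vanish, but the right side is then zero and the
  -- left is `-q |y|²`.
  rcases h1.eq_or_lt with rfl | h1
  · have : 0 ≤ q * (y.re * y.re + y.im * y.im) :=
      mul_nonneg h2 (add_nonneg (mul_self_nonneg _) (mul_self_nonneg _))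
    simp only [mul_zero, zero_mul, add_zero]
    linarith
  · have hd : 0 < q + t * p := by positivity
    have : (g.re * g.re + g.im * g.im) * p * (p / (q + t * p)) =
        (2 * p * (y.re * g.re - -y.im * g.im) - (q + t * p) * (y.re * y.re + y.im * y.im)) +
        (((q + t * p) * y.re - p * g.re) ^ 2 + ((q + t * p) * y.im - p * g.im) ^ 2) /
          (q + t * p) := by
      field_simp
      ring
    rw [this]
    have : 0 ≤ (((q + t * p) * y.re - p * g.re) ^ 2 + ((q + t * p) * y.im - p * g.im) ^ 2) /
          (q + t * p) := by positivity
    linarith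

theorem exists_quasiForm_eq_quasiEntropy (hU : IsDiagonalization U p ρ)
    (hV : IsDiagonalization V q σ) (hp : ∀ i, 0 ≤ p i) (hq : ∀ i, 0 ≤ q i) {t : ℝ} (ht : 0 < t) :
    ∃ X, quasiForm ρ σ t X = quasiEntropy U p V q t := by
  -- The entrywise maximizer, where the completed square vanishes.
  refine ⟨V * (Matrix.of fun j i => ((p i / (q j + t * p i) : ℝ) : ℂ) * (Vᴴ * U) j i) * Uᴴ, ?_⟩
  rw [quasiForm_conj hU hV, quasiEntropy]
  refine Finset.sum_congr rfl fun s _ => ?_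
  rw [of_apply]
  generalize (Vᴴ * U) s.2 s.1 = g
  have h1 := hp s.1
  have h2 := hq s.2
  generalize p s.1 = p at *
  generalize q s.2 = q at *
  rw [star_mul', RCLike.star_def, Complex.conj_ofReal, mul_assoc (Complex.ofReal _),
    mul_comm ((starRingEnd ℂ) g), Complex.mul_conj, Complex.normSq_mul, Complex.normSq_ofReal,
    ← Complex.ofReal_mul, Complex.ofReal_re]
  rcases h1.eq_or_lt with rfl | h1
  · simp
  · have hd : 0 < q + t * p := by positivity
    field_simp
    ring

/-- A Schwarz inequality for the unital adjoint map, with `X` the image of `Y`: the difference of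
the two sides is the trace of `∑ (Y Kᵢ - Kᵢ X) Z (Y Kᵢ - Kᵢ X)ᴴ`, which is positive semidefinite. -/
theorem IsKraus.trace_conj_le {K : r → Matrix l k ℂ} {N : Matrix k k ℂ →ₗ[ℂ] Matrix l l ℂ}
    (hK : IsKraus K N) {Z : Matrix k k ℂ} (hZ : Z.PosSemidef) (Y : Matrix l l ℂ)
    {X : Matrix k k ℂ} (hX : X = ∑ i, (K i)ᴴ * Y * K i) :
    (X * Z * Xᴴ).trace.re ≤ (Y * N Z * Yᴴ).trace.re := by
  have hX' : Xᴴ = ∑ i, (K i)ᴴ * Yᴴ * K i := by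
    rw [hX, conjTranspose_sum]
    simp [conjTranspose_mul, Matrix.mul_assoc]
  have key : (∑ i, (Y * K i - K i * X) * Z * (Y * K i - K i * X)ᴴ).trace =
      (Y * N Z * Yᴴ).trace - (X * Z * Xᴴ).trace := by
    have a1 : ∑ i, (Y * K i * Z * (Y * K i)ᴴ).trace = (Y * N Z * Yᴴ).trace := by
      rw [hK.apply_eq, Matrix.mul_sum, Matrix.sum_mul, trace_sum]
      simp [conjTranspose_mul, Matrix.mul_assoc]
    have a2 : ∑ i, (Y * K i * Z * (K i * X)ᴴ).trace = (X * Z * Xᴴ).trace := by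
      nth_rewrite 2 [hX]
      rw [Matrix.sum_mul, Matrix.sum_mul, trace_sum]
      refine Finset.sum_congr rfl fun i _ => ?_
      rw [conjTranspose_mul, ← Matrix.mul_assoc, trace_mul_comm]
      simp only [Matrix.mul_assoc]
    have a3 : ∑ i, (K i * X * Z * (Y * K i)ᴴ).trace = (X * Z * Xᴴ).trace := by
      rw [hX', Matrix.mul_sum, trace_sum]
      refine Finset.sum_congr rfl fun i _ => ?_
      rw [conjTranspose_mul, Matrix.mul_assoc, Matrix.mul_assoc, trace_mul_comm]
      simp only [Matrix.mul_assoc]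
    have a4 : ∑ i, (K i * X * Z * (K i * X)ᴴ).trace = (X * Z * Xᴴ).trace := by
      have : ∀ i, (K i * X * Z * (K i * X)ᴴ).trace = ((K i)ᴴ * K i * (X * Z * Xᴴ)).trace := by
        intro i
        rw [conjTranspose_mul, ← Matrix.mul_assoc, trace_mul_comm]
        simp only [Matrix.mul_assoc]
      simp_rw [this]
      rw [← trace_sum, ← Matrix.sum_mul, hK.sum_eq_one, one_mul]
    rw [trace_sum]
    simp only [conjTranspose_sub, Matrix.sub_mul, Matrix.mul_sub, trace_sub,
      Finset.sum_sub_distrib, a1, a2, a3, a4]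
    ring
  have hpos := (posSemidef_sum Finset.univ fun i _ =>
    hZ.mul_mul_conjTranspose_same (Y * K i - K i * X)).trace_nonneg
  rw [key, Complex.nonneg_iff, Complex.sub_re] at hpos
  linarith [hpos.1]

/-- Under pullback by the adjoint map the linear term is unchanged, and neither subtracted quadratic
term increases. -/
theorem IsKraus.exists_quasiForm_le {K : r → Matrix l k ℂ}
    {N : Matrix k k ℂ →ₗ[ℂ] Matrix l l ℂ} (hK : IsKraus K N) (hρ : ρ.PosSemidef)
    (hσ : σ.PosSemidef) {t : ℝ} (ht : 0 < t) (Y : Matrix l l ℂ) :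
    ∃ X, quasiForm (N ρ) (N σ) t Y ≤ quasiForm ρ σ t X := by
  refine ⟨∑ i, (K i)ᴴ * Y * K i, ?_⟩
  set X := ∑ i, (K i)ᴴ * Y * K i with hX
  have hX' : Xᴴ = ∑ i, (K i)ᴴ * Yᴴ * K i := by
    rw [hX, conjTranspose_sum]
    simp [conjTranspose_mul, Matrix.mul_assoc]
  have h1 := hK.trace_conj_le hρ Y hX
  have h2 := hK.trace_conj_le hσ Yᴴ hX'
  rw [conjTranspose_conjTranspose, conjTranspose_conjTranspose] at h2
  have h3 : (Yᴴ * N ρ).trace = (Xᴴ * ρ).trace := by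
    rw [hX', hK.apply_eq, Matrix.mul_sum, Matrix.sum_mul, trace_sum, trace_sum]
    refine Finset.sum_congr rfl fun i _ => ?_
    rw [← Matrix.mul_assoc, trace_mul_comm]
    simp only [Matrix.mul_assoc]
  rw [quasiForm, quasiForm, h3]
  have := mul_le_mul_of_nonneg_left h1 ht.le
  linarith

theorem IsKraus.quasiEntropy_le [DecidableEq l] {K : r → Matrix l k ℂ}
    {N : Matrix k k ℂ →ₗ[ℂ] Matrix l l ℂ} (hK : IsKraus K N) (hρ : ρ.PosSemidef)
    (hσ : σ.PosSemidef) (hU : IsDiagonalization U p ρ) (hV : IsDiagonalization V q σ)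
    (hp : ∀ i, 0 ≤ p i) (hq : ∀ i, 0 ≤ q i) {U' V' : Matrix l l ℂ} {p' q' : l → ℝ}
    (hU' : IsDiagonalization U' p' (N ρ)) (hV' : IsDiagonalization V' q' (N σ))
    (hp' : ∀ i, 0 ≤ p' i) (hq' : ∀ i, 0 ≤ q' i) {t : ℝ} (ht : 0 < t) :
    quasiEntropy U' p' V' q' t ≤ quasiEntropy U p V q t := by
  obtain ⟨Y, hY⟩ := exists_quasiForm_eq_quasiEntropy hU' hV' hp' hq' ht
  obtain ⟨X, hX⟩ := hK.exists_quasiForm_le hρ hσ ht Y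
  exact hY ▸ hX.trans (quasiForm_le_quasiEntropy hU hV hp hq ht X)

end Monotonicity

/-! ### Partial trace over the first factor. -/

section Reduced

variable {a m c d : Type*} [Fintype a] [Fintype m]

theorem reduced_posSemidef {ρ : Matrix (a × c) (a × c) ℂ} (h : ρ.PosSemidef) :
    (reduced ρ).PosSemidef := by
  have : reduced ρ = ∑ i, ρ.submatrix (Prod.mk i) (Prod.mk i) := by
    ext j k
    simp [reduced, Matrix.sum_apply]
  rw [this]
  exact posSemidef_sum _ fun i _ => h.submatrix _

theorem trace_reduced [Fintype c] (ρ : Matrix (a × c) (a × c) ℂ) : (reduced ρ).trace = ρ.trace := by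
  simp only [Matrix.trace, diag_apply, reduced, of_apply]
  rw [Fintype.sum_prod_type, Finset.sum_comm]

theorem reduced_isDensity [Fintype c] {ρ : Matrix (a × c) (a × c) ℂ} (h : IsDensity ρ) :
    IsDensity (reduced ρ) :=
  ⟨reduced_posSemidef h.1, (trace_reduced ρ).trans h.2⟩

theorem reduced_kronMap {Φ : Matrix m m ℂ →ₗ[ℂ] Matrix a a ℂ}
    (hΦ : ∀ x, (Φ x).trace = x.trace) (Ψ : Matrix c c ℂ →ₗ[ℂ] Matrix d d ℂ)
    (ρ : Matrix (m × c) (m × c) ℂ) : reduced (kronMap Φ Ψ ρ) = Ψ (reduced ρ) := by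
  have hr : reduced ρ = ∑ i, Matrix.of fun j k => ρ (i, j) (i, k) := by
    ext j k
    simp [reduced, Matrix.sum_apply]
  ext j k
  rw [hr, map_sum, Matrix.sum_apply]
  exact hΦ (Matrix.of fun p p' => Ψ (Matrix.of fun q q' => ρ (p, q) (p', q')) j k)

theorem reduced_conj_one_kronecker [Fintype c] [DecidableEq a] (W : Matrix c c ℂ)
    (ρ : Matrix (a × c) (a × c) ℂ) :
    reduced (((1 : Matrix a a ℂ) ⊗ₖ W)ᴴ * ρ * ((1 : Matrix a a ℂ) ⊗ₖ W)) =
      Wᴴ * reduced ρ * W := by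
  have h : ∀ i j k, (((1 : Matrix a a ℂ) ⊗ₖ W)ᴴ * ρ * ((1 : Matrix a a ℂ) ⊗ₖ W)) (i, j) (i, k) =
      (Wᴴ * ρ.submatrix (Prod.mk i) (Prod.mk i) * W) j k := by
    intro i j k
    simp only [mul_apply, conjTranspose_apply, kroneckerMap_apply, one_apply, submatrix_apply,
      Fintype.sum_prod_type, star_mul']
    simp [apply_ite, ite_mul, Finset.sum_ite_eq']
  have hr : reduced ρ = ∑ i, ρ.submatrix (Prod.mk i) (Prod.mk i) := by
    ext j k
    simp [reduced, Matrix.sum_apply]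
  ext j k
  rw [hr, Matrix.mul_sum, Matrix.sum_mul, Matrix.sum_apply]
  exact Finset.sum_congr rfl fun i _ => h i j k

end Reduced

/-! ### Squared overlaps of two orthonormal bases. -/

section Overlap

variable {n : Type*} [Fintype n] [DecidableEq n] {U V : Matrix n n ℂ} {p : n → ℝ}
  {ρ : Matrix n n ℂ}

theorem IsDiagonalization.sum_normSq_left (hU : IsDiagonalization U p ρ) (hV : Vᴴ * V = 1)
    (i : n) : ∑ j, Complex.normSq ((Vᴴ * U) j i) = 1 := by
  have h : ((Vᴴ * U)ᴴ * (Vᴴ * U)) i i = 1 := by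
    have : (Vᴴ * U)ᴴ * (Vᴴ * U) = Uᴴ * (V * Vᴴ) * U := by
      simp only [conjTranspose_mul, conjTranspose_conjTranspose, mul_assoc]
    rw [this, mul_eq_one_comm.mp hV, mul_one, hU.unitary, one_apply_eq]
  rw [mul_apply] at h
  simp only [conjTranspose_apply, RCLike.star_def, ← Complex.normSq_eq_conj_mul_self] at h
  exact_mod_cast h

theorem IsDiagonalization.sum_normSq_mul_eq_sum (hU : IsDiagonalization U p ρ)
    (hV : Vᴴ * V = 1) :
    ∑ s : n × n, Complex.normSq ((Vᴴ * U) s.2 s.1) * p s.1 = ∑ i, p i := by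
  rw [Fintype.sum_prod_type]
  simp only [← Finset.sum_mul, hU.sum_normSq_left hV, one_mul]

theorem IsDiagonalization.sum_normSq_mul (hU : IsDiagonalization U p ρ) (V : Matrix n n ℂ)
    (j : n) : ((∑ i, Complex.normSq ((Vᴴ * U) j i) * p i : ℝ) : ℂ) = (Vᴴ * ρ * V) j j := by
  have h : Vᴴ * ρ * V = (Vᴴ * U) * diagonal (fun i => (p i : ℂ)) * (Vᴴ * U)ᴴ := by
    rw [hU.eq]
    simp only [conjTranspose_mul, conjTranspose_conjTranspose, mul_assoc]
  rw [h, mul_apply, Complex.ofReal_sum]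
  refine Finset.sum_congr rfl fun i _ => ?_
  rw [mul_diagonal, conjTranspose_apply, RCLike.star_def, mul_right_comm, Complex.mul_conj,
    Complex.ofReal_mul]

end Overlap

/-! ### Conditional entropy as a relative entropy; data processing. -/

section ConditionalEntropy

variable {a c : Type*} [Fintype a] [Fintype c] [DecidableEq a] [DecidableEq c]
  {U : Matrix (a × c) (a × c) ℂ} {p : a × c → ℝ} {W : Matrix c c ℂ} {q : c → ℝ}
  {ρ : Matrix (a × c) (a × c) ℂ}

theorem sum_sum_normSq_mul_eq (hU : IsDiagonalization U p ρ)
    (hW : IsDiagonalization W q (reduced ρ)) (k : c) :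
    ∑ x, ∑ i, Complex.normSq ((((1 : Matrix a a ℂ) ⊗ₖ W)ᴴ * U) (x, k) i) * p i = q k := by
  have h1 : (Wᴴ * reduced ρ * W) k k = (q k : ℂ) := by
    have : Wᴴ * reduced ρ * W = (Wᴴ * W) * diagonal (fun i => (q i : ℂ)) * (Wᴴ * W) := by
      rw [hW.eq]; simp only [mul_assoc]
    rw [this, hW.unitary, one_mul, mul_one, diagonal_apply_eq]
  rw [← reduced_conj_one_kronecker] at h1
  simp only [reduced, of_apply, ← hU.sum_normSq_mul] at h1
  exact_mod_cast h1

/-- The support of ρ lies in that of 1 ⊗ ρ_C: a zero eigenvalue `q k` is a sum of nonnegative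
weights, which must all vanish. Thus the value of `Real.log 0` never matters. -/
theorem normSq_mul_ne_zero (hU : IsDiagonalization U p ρ)
    (hW : IsDiagonalization W q (reduced ρ)) (hp : ∀ i, 0 ≤ p i) (hq : ∀ i, 0 ≤ q i)
    {i j : a × c} (h : Complex.normSq ((((1 : Matrix a a ℂ) ⊗ₖ W)ᴴ * U) j i) * p i ≠ 0) :
    0 < p i ∧ 0 < q j.2 := by
  refine ⟨(hp i).lt_of_ne fun h0 => h (by rw [← h0, mul_zero]), (hq _).lt_of_ne fun h0 => h ?_⟩
  have hs := sum_sum_normSq_mul_eq hU hW j.2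
  have hnn : ∀ x i, 0 ≤ Complex.normSq ((((1 : Matrix a a ℂ) ⊗ₖ W)ᴴ * U) (x, j.2) i) * p i :=
    fun x i => mul_nonneg (Complex.normSq_nonneg _) (hp i)
  rw [← h0, Finset.sum_eq_zero_iff_of_nonneg fun x _ => Finset.sum_nonneg fun i _ => hnn x i] at hs
  have hs' := hs j.1 (Finset.mem_univ _)
  rw [Finset.sum_eq_zero_iff_of_nonneg fun i _ => hnn _ i] at hs'
  exact hs' i (Finset.mem_univ _)

/-- The left side is the relative entropy of ρ to 1 ⊗ ρ_C: summing the weights over the second basis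
leaves `p`, and summing them over all but the memory index leaves `q`. -/
theorem sum_normSq_mul_log_eq (hU : IsDiagonalization U p ρ)
    (hW : IsDiagonalization W q (reduced ρ)) :
    ∑ s : (a × c) × (a × c), Complex.normSq ((((1 : Matrix a a ℂ) ⊗ₖ W)ᴴ * U) s.2 s.1) * p s.1 *
      (Real.log (p s.1) - Real.log (q s.2.2)) = -condEntropy ρ := by
  have hV : ((1 : Matrix a a ℂ) ⊗ₖ W)ᴴ * ((1 : Matrix a a ℂ) ⊗ₖ W) = 1 :=
    (isDiagonalization_one.kronecker hW).unitary
  have h1 : ∑ s : (a × c) × (a × c), Complex.normSq ((((1 : Matrix a a ℂ) ⊗ₖ W)ᴴ * U) s.2 s.1) *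
      p s.1 * Real.log (p s.1) = -entropy ρ := by
    rw [hU.entropy_eq, Fintype.sum_prod_type, ← Finset.sum_neg_distrib]
    refine Finset.sum_congr rfl fun i _ => ?_
    simp only [← Finset.sum_mul]
    rw [hU.sum_normSq_left hV, Real.negMulLog]
    ring
  have h2 : ∑ s : (a × c) × (a × c), Complex.normSq ((((1 : Matrix a a ℂ) ⊗ₖ W)ᴴ * U) s.2 s.1) *
      p s.1 * Real.log (q s.2.2) = -entropy (reduced ρ) := by
    rw [hW.entropy_eq, Fintype.sum_prod_type, Finset.sum_comm, Fintype.sum_prod_type,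
      Finset.sum_comm, ← Finset.sum_neg_distrib]
    refine Finset.sum_congr rfl fun k _ => ?_
    simp only [← Finset.sum_mul]
    rw [sum_sum_normSq_mul_eq hU hW, Real.negMulLog]
    ring
  simp only [mul_sub, Finset.sum_sub_distrib, h1, h2, condEntropy]
  ring

variable {d r : Type*} [Fintype d] [DecidableEq d] [Fintype r]

/-- Data processing: a channel on the memory does not decrease the conditional entropy. -/
theorem IsKraus.condEntropy_le {K : r → Matrix d c ℂ} {N : Matrix c c ℂ →ₗ[ℂ] Matrix d d ℂ}
    (hK : IsKraus K N) (hρ : ρ.PosSemidef) :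
    condEntropy ρ ≤ condEntropy (kronMap (LinearMap.id : Matrix a a ℂ →ₗ[ℂ] Matrix a a ℂ) N ρ) := by
  have hN := (isKraus_id (m := a)).tensor hK
  set N' := kronMap (LinearMap.id : Matrix a a ℂ →ₗ[ℂ] Matrix a a ℂ) N with hN'
  have hred : reduced (N' ρ) = N (reduced ρ) := reduced_kronMap (fun _ => rfl) N ρ
  have hρ' := hN.posSemidef hρ
  obtain ⟨U, p, hU, hp⟩ := exists_isDiagonalization hρ
  obtain ⟨W, q, hW, hq⟩ := exists_isDiagonalization (reduced_posSemidef hρ)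
  obtain ⟨U', p', hU', hp'⟩ := exists_isDiagonalization hρ'
  obtain ⟨W', q', hW', hq'⟩ := exists_isDiagonalization (reduced_posSemidef hρ')
  have hV := (isDiagonalization_one (n := a)).kronecker hW
  have hV' := (isDiagonalization_one (n := a)).kronecker hW'
  -- The reference operator of the output is the image of that of the input: 1 ⊗ N(ρ_C) = (id ⊗ N)(1
  -- ⊗ ρ_C).
  rw [hred, ← LinearMap.id_apply (R := ℂ) (1 : Matrix a a ℂ), ← kronMap_kronecker, ← hN'] at hV'
  simp only [LinearMap.id_apply, one_mul] at hV hV'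
  rw [← neg_le_neg_iff, ← sum_normSq_mul_log_eq hU hW, ← sum_normSq_mul_log_eq hU' hW']
  have hσ : ((1 : Matrix a a ℂ) ⊗ₖ reduced ρ).PosSemidef :=
    PosSemidef.one.kronecker (reduced_posSemidef hρ)
  refine sum_mul_log_sub_log_le (I := (a × c) × (a × c)) (J := (a × d) × (a × d))
    (fun s => hp s.1) (fun s hs => normSq_mul_ne_zero hU hW hp hq hs)
    (fun s => hp' s.1) (fun s hs => normSq_mul_ne_zero hU' hW' hp' hq' hs) ?_ ?_
  · have h1 : ∑ i, p i = ∑ i, p' i := by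
      have := hN.trace_apply ρ
      rw [hU.trace_eq, hU'.trace_eq] at this
      exact_mod_cast this.symm
    rw [hU.sum_normSq_mul_eq_sum hV.unitary, hU'.sum_normSq_mul_eq_sum hV'.unitary, h1]
  · intro t ht
    exact hN.quasiEntropy_le hρ hσ hU hV hp (fun s => hq s.2) hU' hV' hp' (fun s => hq' s.2) ht

end ConditionalEntropy

/-! ### Chain rule, superadditivity and product states. -/

section Additivity

/-- Maps acting on different tensor factors commute: both sides expand over matrix units to the same
double sum. -/
theorem linearMap_apply_swap {m n a b : Type*} [Fintype m] [Fintype n] [DecidableEq m]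
    [DecidableEq n] (Φ : Matrix m m ℂ →ₗ[ℂ] Matrix a a ℂ) (Ψ : Matrix n n ℂ →ₗ[ℂ] Matrix b b ℂ)
    (X : m → m → n → n → ℂ) (u u' : a) (v v' : b) :
    Φ (Matrix.of fun i i' => Ψ (Matrix.of fun j j' => X i i' j j') v v') u u' =
      Ψ (Matrix.of fun j j' => Φ (Matrix.of fun i i' => X i i' j j') u u') v v' := by
  have h1 : Φ (Matrix.of fun i i' => Ψ (Matrix.of fun j j' => X i i' j j') v v') u u' =
      ∑ i, ∑ i', (∑ j, ∑ j', X i i' j j' * Ψ (Matrix.single j j' 1) v v') *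
        Φ (Matrix.single i i' 1) u u' := by
    rw [linearMap_apply_eq_sum Φ]
    exact Finset.sum_congr rfl fun i _ => Finset.sum_congr rfl fun i' _ =>
      congrArg (· * _) (linearMap_apply_eq_sum Ψ _ v v')
  have h2 : Ψ (Matrix.of fun j j' => Φ (Matrix.of fun i i' => X i i' j j') u u') v v' =
      ∑ j, ∑ j', (∑ i, ∑ i', X i i' j j' * Φ (Matrix.single i i' 1) u u') *
        Ψ (Matrix.single j j' 1) v v' := by
    rw [linearMap_apply_eq_sum Ψ]
    exact Finset.sum_congr rfl fun j _ => Finset.sum_congr rfl fun j' _ =>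
      congrArg (· * _) (linearMap_apply_eq_sum Φ _ u u')
  have h3 := Finset.sum_comm (s := (Finset.univ : Finset (m × m)))
    (t := (Finset.univ : Finset (n × n))) (f := fun s t => X s.1 s.2 t.1 t.2 *
      Ψ (Matrix.single t.1 t.2 1) v v' * Φ (Matrix.single s.1 s.2 1) u u')
  simp only [Fintype.sum_prod_type] at h3
  rw [h1, h2]
  simp only [Finset.sum_mul]
  rw [h3]
  simp only [mul_right_comm]

theorem isDensity_submatrix {c d : Type*} [Fintype c] [Fintype d] {ρ : Matrix c c ℂ} (h : IsDensity ρ)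
    (e : d ≃ c) :
    IsDensity (ρ.submatrix e e) := by
  refine ⟨h.1.submatrix e, ?_⟩
  rw [← h.2]
  exact e.sum_comp fun i => ρ i i

theorem IsDensity.kronecker {c d : Type*} [Fintype c] [Fintype d] {x : Matrix c c ℂ} {y : Matrix d d ℂ}
    (hx : IsDensity x) (hy : IsDensity y) : IsDensity (x ⊗ₖ y) :=
  ⟨hx.1.kronecker hy.1, by rw [trace_kronecker, hx.2, hy.2, mul_one]⟩

/-- The bijection regarding the first of two systems as part of the memory. -/
def absorbEquiv (m n c : Type*) : n × (m × c) ≃ (m × n) × c where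
  toFun s := ((s.2.1, s.1), s.2.2)
  invFun s := (s.1.2, (s.1.1, s.2))

theorem kronMap_submatrix_absorbEquiv {m n a b c : Type*} [Fintype m] [Fintype n]
    [DecidableEq m] [DecidableEq n] (Φ : Matrix m m ℂ →ₗ[ℂ] Matrix a a ℂ)
    (Ψ : Matrix n n ℂ →ₗ[ℂ] Matrix b b ℂ) (ρ : Matrix ((m × n) × c) ((m × n) × c) ℂ) :
    (kronMap (kronMap Φ Ψ) (LinearMap.id : Matrix c c ℂ →ₗ[ℂ] Matrix c c ℂ) ρ).submatrix
        (absorbEquiv a b c) (absorbEquiv a b c) =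
      kronMap Ψ (kronMap Φ (LinearMap.id : Matrix c c ℂ →ₗ[ℂ] Matrix c c ℂ))
        (ρ.submatrix (absorbEquiv m n c) (absorbEquiv m n c)) := by
  ext ⟨v, u, z⟩ ⟨v', u', z'⟩
  exact linearMap_apply_swap Φ Ψ (fun i i' j j' => ρ ((i, j), z) ((i', j'), z')) u u' v v'

theorem kronMap_id_kronMap_id {m a c d : Type*} [Fintype m] [Fintype c] [DecidableEq m]
    [DecidableEq c] (Φ : Matrix m m ℂ →ₗ[ℂ] Matrix a a ℂ)
    (N : Matrix c c ℂ →ₗ[ℂ] Matrix d d ℂ) (ρ : Matrix (m × c) (m × c) ℂ) :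
    kronMap (LinearMap.id : Matrix a a ℂ →ₗ[ℂ] Matrix a a ℂ) N
      (kronMap Φ (LinearMap.id : Matrix c c ℂ →ₗ[ℂ] Matrix c c ℂ) ρ) = kronMap Φ N ρ := by
  ext ⟨u, v⟩ ⟨u', v'⟩
  exact (linearMap_apply_swap Φ N (fun i i' j j' => ρ (i, j) (i', j')) u u' v v').symm

theorem kronMap_kronMap_id_kronecker {m n a b c d : Type*}
    (Φ : Matrix m m ℂ →ₗ[ℂ] Matrix a a ℂ)
    (Ψ : Matrix n n ℂ →ₗ[ℂ] Matrix b b ℂ) (x : Matrix (m × c) (m × c) ℂ)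
    (y : Matrix (n × d) (n × d) ℂ) :
    kronMap (kronMap Φ Ψ) (LinearMap.id : Matrix (c × d) (c × d) ℂ →ₗ[ℂ] _)
        ((x ⊗ₖ y).submatrix (Equiv.prodProdProdComm m n c d) (Equiv.prodProdProdComm m n c d)) =
      (kronMap Φ (LinearMap.id : Matrix c c ℂ →ₗ[ℂ] _) x ⊗ₖ
        kronMap Ψ (LinearMap.id : Matrix d d ℂ →ₗ[ℂ] _) y).submatrix
          (Equiv.prodProdProdComm a b c d) (Equiv.prodProdProdComm a b c d) := by
  ext ⟨⟨u, v⟩, k, l⟩ ⟨⟨u', v'⟩, k', l'⟩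
  exact congrFun (congrFun (kronMap_kronecker Φ Ψ (Matrix.of fun i i' => x (i, k) (i', k'))
    (Matrix.of fun j j' => y (j, l) (j', l'))) (u, v)) (u', v')

theorem IsKraus.isChannel {m a r : Type*} [Fintype m] [DecidableEq m] [Fintype a]
    [Fintype r] {K : r → Matrix a m ℂ}
    {Φ : Matrix m m ℂ →ₗ[ℂ] Matrix a a ℂ} (hK : IsKraus K Φ) : IsChannel Φ where
  completelyPositive _ _ hX := (hK.tensor isKraus_id).posSemidef hX
  tracePreserving := hK.trace_apply

variable {m a b n a' b' c d : Type*} [Fintype m] [Fintype a] [Fintype b] [Fintype n] [Fintype a']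
  [Fintype b'] [Fintype c] [Fintype d] [DecidableEq m] [DecidableEq a] [DecidableEq b]
  [DecidableEq n] [DecidableEq a'] [DecidableEq b'] [DecidableEq c] [DecidableEq d]

theorem condEntropy_submatrix_memory {ρ : Matrix (m × c) (m × c) ℂ} (h : ρ.PosSemidef)
    (e : d ≃ c) :
    condEntropy (ρ.submatrix ((Equiv.refl m).prodCongr e) ((Equiv.refl m).prodCongr e)) =
      condEntropy ρ := by
  have hr : reduced (ρ.submatrix ((Equiv.refl m).prodCongr e) ((Equiv.refl m).prodCongr e)) =
      (reduced ρ).submatrix e e := rfl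
  rw [condEntropy, condEntropy, hr, entropy_submatrix h.1,
    entropy_submatrix (reduced_posSemidef h).1]

theorem IsChannel.tensor {Φ : Matrix m m ℂ →ₗ[ℂ] Matrix a a ℂ}
    {Ψ : Matrix n n ℂ →ₗ[ℂ] Matrix b b ℂ} (hΦ : IsChannel Φ) (hΨ : IsChannel Ψ) :
    IsChannel (kronMap Φ Ψ) := by
  obtain ⟨K, hK⟩ := hΦ.exists_isKraus
  obtain ⟨L, hL⟩ := hΨ.exists_isKraus
  exact (hK.tensor hL).isChannel

theorem IsChannel.posSemidef_kronMap_id {Φ : Matrix m m ℂ →ₗ[ℂ] Matrix a a ℂ} (hΦ : IsChannel Φ)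
    {ρ : Matrix (m × c) (m × c) ℂ} (h : ρ.PosSemidef) :
    (kronMap Φ (LinearMap.id : Matrix c c ℂ →ₗ[ℂ] Matrix c c ℂ) ρ).PosSemidef := by
  obtain ⟨K, hK⟩ := hΦ.exists_isKraus
  exact (hK.tensor isKraus_id).posSemidef h

theorem IsChannel.isDensity_kronMap_id {Φ : Matrix m m ℂ →ₗ[ℂ] Matrix a a ℂ} (hΦ : IsChannel Φ)
    {ρ : Matrix (m × c) (m × c) ℂ} (h : IsDensity ρ) :
    IsDensity (kronMap Φ (LinearMap.id : Matrix c c ℂ →ₗ[ℂ] Matrix c c ℂ) ρ) := by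
  obtain ⟨K, hK⟩ := hΦ.exists_isKraus
  exact (hK.tensor isKraus_id).isDensity h

/-- The infimum may be taken over memory systems indexed by arbitrary finite types. -/
theorem minUncertainty_le_condInfo {ΦA : Matrix m m ℂ →ₗ[ℂ] Matrix a a ℂ}
    {ΦB : Matrix m m ℂ →ₗ[ℂ] Matrix b b ℂ} (hA : IsChannel ΦA) (hB : IsChannel ΦB)
    {ρ : Matrix (m × c) (m × c) ℂ} (hρ : IsDensity ρ) :
    minUncertainty ΦA ΦB ≤ (condInfo ΦA ΦB ρ : EReal) := by
  let e := (Fintype.equivFin c).symm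
  let e' := (Equiv.refl m).prodCongr e
  have he : condInfo ΦA ΦB (ρ.submatrix e' e') = condInfo ΦA ΦB ρ := by
    rw [condInfo, condInfo, condEntropy_submatrix_memory hρ.1 e,
      ← condEntropy_submatrix_memory (hA.posSemidef_kronMap_id hρ.1) e,
      ← condEntropy_submatrix_memory (hB.posSemidef_kronMap_id hρ.1) e]
    rfl
  rw [← he]
  exact (iInf_le _ (Fintype.card c)).trans
    (iInf_le (fun ρ : {ρ : Matrix (m × Fin (Fintype.card c)) (m × Fin (Fintype.card c)) ℂ //
      IsDensity ρ} => (condInfo ΦA ΦB ρ.1 : EReal)) ⟨_, isDensity_submatrix hρ e'⟩)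

/-- The chain rule H(MN|C) = H(N|MC) + H(M|C); the entropy of MC cancels. -/
theorem condEntropy_chain {τ : Matrix ((m × n) × c) ((m × n) × c) ℂ} (h : τ.PosSemidef) :
    condEntropy τ = condEntropy (τ.submatrix (absorbEquiv m n c) (absorbEquiv m n c)) +
      condEntropy (reduced (τ.submatrix (absorbEquiv m n c) (absorbEquiv m n c))) := by
  have hr : reduced (reduced (τ.submatrix (absorbEquiv m n c) (absorbEquiv m n c))) =
      reduced τ := by
    ext k l
    simp only [reduced, of_apply, submatrix_apply, Fintype.sum_prod_type]
    rfl
  rw [condEntropy, condEntropy, condEntropy, entropy_submatrix h.1, hr]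
  ring

/-- After the chain rule on the output, Φ acts on the memory of the first summand, where data
processing removes it. -/
theorem condEntropy_kronMap_kronMap_ge {Φ : Matrix m m ℂ →ₗ[ℂ] Matrix a a ℂ}
    {Ψ : Matrix n n ℂ →ₗ[ℂ] Matrix b b ℂ} (hΦ : IsChannel Φ) (hΨ : IsChannel Ψ)
    {ρ : Matrix ((m × n) × c) ((m × n) × c) ℂ} (hρ : ρ.PosSemidef) :
    condEntropy (kronMap Ψ (LinearMap.id : Matrix (m × c) (m × c) ℂ →ₗ[ℂ] _)
        (ρ.submatrix (absorbEquiv m n c) (absorbEquiv m n c))) +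
      condEntropy (kronMap Φ (LinearMap.id : Matrix c c ℂ →ₗ[ℂ] Matrix c c ℂ)
        (reduced (ρ.submatrix (absorbEquiv m n c) (absorbEquiv m n c)))) ≤
    condEntropy (kronMap (kronMap Φ Ψ) (LinearMap.id : Matrix c c ℂ →ₗ[ℂ] Matrix c c ℂ) ρ) := by
  obtain ⟨K, hK⟩ := hΦ.exists_isKraus
  have hN := hK.tensor (isKraus_id (m := c))
  have hle := hN.condEntropy_le
    (hΨ.posSemidef_kronMap_id (hρ.submatrix (absorbEquiv m n c)))
  rw [kronMap_id_kronMap_id] at hle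
  have hch := condEntropy_chain ((hΦ.tensor hΨ).posSemidef_kronMap_id hρ)
  rw [kronMap_submatrix_absorbEquiv, reduced_kronMap hΨ.tracePreserving] at hch
  rw [hch]
  exact add_le_add_left hle _

/-- Both output terms obey the previous inequality, and the subtracted input term obeys the chain
rule with equality. -/
theorem condInfo_superadditive {ΦA : Matrix m m ℂ →ₗ[ℂ] Matrix a a ℂ}
    {ΦB : Matrix m m ℂ →ₗ[ℂ] Matrix b b ℂ} {ΨA : Matrix n n ℂ →ₗ[ℂ] Matrix a' a' ℂ}
    {ΨB : Matrix n n ℂ →ₗ[ℂ] Matrix b' b' ℂ} (hΦA : IsChannel ΦA) (hΦB : IsChannel ΦB)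
    (hΨA : IsChannel ΨA) (hΨB : IsChannel ΨB) {ρ : Matrix ((m × n) × c) ((m × n) × c) ℂ}
    (hρ : ρ.PosSemidef) :
    condInfo ΦA ΦB (reduced (ρ.submatrix (absorbEquiv m n c) (absorbEquiv m n c))) +
      condInfo ΨA ΨB (ρ.submatrix (absorbEquiv m n c) (absorbEquiv m n c)) ≤
    condInfo (kronMap ΦA ΨA) (kronMap ΦB ΨB) ρ := by
  have h1 := condEntropy_kronMap_kronMap_ge hΦA hΨA hρ
  have h2 := condEntropy_kronMap_kronMap_ge hΦB hΨB hρ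
  have h3 := condEntropy_chain hρ
  simp only [condInfo]
  linarith

theorem condEntropy_kronecker {x : Matrix (m × c) (m × c) ℂ} {y : Matrix (n × d) (n × d) ℂ}
    (hx : IsDensity x) (hy : IsDensity y) :
    condEntropy ((x ⊗ₖ y).submatrix (Equiv.prodProdProdComm m n c d)
      (Equiv.prodProdProdComm m n c d)) = condEntropy x + condEntropy y := by
  have hr : reduced ((x ⊗ₖ y).submatrix (Equiv.prodProdProdComm m n c d)
      (Equiv.prodProdProdComm m n c d)) = reduced x ⊗ₖ reduced y := by
    ext ⟨k, l⟩ ⟨k', l'⟩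
    simp only [reduced, of_apply, submatrix_apply, kroneckerMap_apply, Fintype.sum_prod_type,
      Finset.sum_mul_sum]
    rfl
  rw [condEntropy, hr, entropy_submatrix (hx.1.kronecker hy.1).1, entropy_kronecker hx hy,
    entropy_kronecker (reduced_isDensity hx) (reduced_isDensity hy), condEntropy, condEntropy]
  ring

theorem condInfo_kronecker {ΦA : Matrix m m ℂ →ₗ[ℂ] Matrix a a ℂ}
    {ΦB : Matrix m m ℂ →ₗ[ℂ] Matrix b b ℂ} {ΨA : Matrix n n ℂ →ₗ[ℂ] Matrix a' a' ℂ}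
    {ΨB : Matrix n n ℂ →ₗ[ℂ] Matrix b' b' ℂ} (hΦA : IsChannel ΦA) (hΦB : IsChannel ΦB)
    (hΨA : IsChannel ΨA) (hΨB : IsChannel ΨB) {x : Matrix (m × c) (m × c) ℂ}
    {y : Matrix (n × d) (n × d) ℂ} (hx : IsDensity x) (hy : IsDensity y) :
    condInfo (kronMap ΦA ΨA) (kronMap ΦB ΨB) ((x ⊗ₖ y).submatrix (Equiv.prodProdProdComm m n c d)
      (Equiv.prodProdProdComm m n c d)) = condInfo ΦA ΦB x + condInfo ΨA ΨB y := by
  rw [condInfo, kronMap_kronMap_id_kronecker, kronMap_kronMap_id_kronecker,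
    condEntropy_kronecker hx hy,
    condEntropy_kronecker (hΦA.isDensity_kronMap_id hx) (hΨA.isDensity_kronMap_id hy),
    condEntropy_kronecker (hΦB.isDensity_kronMap_id hx) (hΨB.isDensity_kronMap_id hy),
    condInfo, condInfo]
  ring

/-- A pure state with one-dimensional memory is a competitor. Dimension 0 carries no density
operator and contributes only `⊤`. -/
theorem minUncertainty_ne_top [Nonempty m] (ΦA : Matrix m m ℂ →ₗ[ℂ] Matrix a a ℂ)
    (ΦB : Matrix m m ℂ →ₗ[ℂ] Matrix b b ℂ) : minUncertainty ΦA ΦB ≠ ⊤ := by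
  let i : m × Fin 1 := (Classical.arbitrary m, 0)
  have hρ : IsDensity (diagonal (Pi.single i 1) : Matrix (m × Fin 1) (m × Fin 1) ℂ) :=
    ⟨PosSemidef.diagonal (Pi.single_nonneg.mpr zero_le_one), by simp [trace_diagonal]⟩
  have h : minUncertainty ΦA ΦB ≤ (condInfo ΦA ΦB (diagonal (Pi.single i 1)) : EReal) :=
    (iInf_le _ 1).trans (iInf_le (fun ρ : {ρ : Matrix (m × Fin 1) (m × Fin 1) ℂ // IsDensity ρ} =>
      (condInfo ΦA ΦB ρ.1 : EReal)) ⟨_, hρ⟩)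
  exact (h.trans_lt (EReal.coe_lt_top _)).ne

theorem exists_condInfo_lt {ΦA : Matrix m m ℂ →ₗ[ℂ] Matrix a a ℂ}
    {ΦB : Matrix m m ℂ →ₗ[ℂ] Matrix b b ℂ} {z : EReal} (h : minUncertainty ΦA ΦB < z) :
    ∃ (k : ℕ) (ρ : Matrix (m × Fin k) (m × Fin k) ℂ), IsDensity ρ ∧
      (condInfo ΦA ΦB ρ : EReal) < z := by
  obtain ⟨k, hk⟩ := iInf_lt_iff.mp h
  obtain ⟨ρ, hρ⟩ := iInf_lt_iff.mp hk
  exact ⟨k, ρ.1, ρ.2, hρ⟩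

end Additivity

end SquashedUncertainty

theorem mainTheorem4
    {m₁ a₁ b₁ m₂ a₂ b₂ : Type*}
    [Fintype m₁] [DecidableEq m₁] [Fintype a₁] [DecidableEq a₁] [Fintype b₁] [DecidableEq b₁]
    [Fintype m₂] [DecidableEq m₂] [Fintype a₂] [DecidableEq a₂] [Fintype b₂] [DecidableEq b₂]
    [Nonempty m₁] [Nonempty m₂]
    (ΦA : Matrix m₁ m₁ ℂ →ₗ[ℂ] Matrix a₁ a₁ ℂ) (ΦB : Matrix m₁ m₁ ℂ →ₗ[ℂ] Matrix b₁ b₁ ℂ)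
    (ΨA : Matrix m₂ m₂ ℂ →ₗ[ℂ] Matrix a₂ a₂ ℂ) (ΨB : Matrix m₂ m₂ ℂ →ₗ[ℂ] Matrix b₂ b₂ ℂ)
    (hΦA : SquashedUncertainty.IsChannel ΦA) (hΦB : SquashedUncertainty.IsChannel ΦB)
    (hΨA : SquashedUncertainty.IsChannel ΨA) (hΨB : SquashedUncertainty.IsChannel ΨB) :
    SquashedUncertainty.minUncertainty (SquashedUncertainty.kronMap ΦA ΨA)
        (SquashedUncertainty.kronMap ΦB ΨB)
      = SquashedUncertainty.minUncertainty ΦA ΦB + SquashedUncertainty.minUncertainty ΨA ΨB := by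
  open SquashedUncertainty in
  apply le_antisymm
  -- Near-minimizers suffice, and no lower bound on the infima is needed: both differ from `⊤`, so
  -- `⊥ + ⊤` does not occur.
  · refine EReal.le_add_of_forall_gt (Or.inr (minUncertainty_ne_top _ _))
      (Or.inl (minUncertainty_ne_top _ _)) fun x hx y hy => ?_
    obtain ⟨k, ρ, hρ, hρx⟩ := exists_condInfo_lt hx
    obtain ⟨l, σ, hσ, hσy⟩ := exists_condInfo_lt hy
    have h := minUncertainty_le_condInfo (hΦA.tensor hΨA) (hΦB.tensor hΨB)
      (isDensity_submatrix (hρ.kronecker hσ) (Equiv.prodProdProdComm _ _ _ _))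
    rw [condInfo_kronecker hΦA hΦB hΨA hΨB hρ hσ, EReal.coe_add] at h
    exact h.trans (add_le_add hρx.le hσy.le)
  -- The pair Ψ is tested with memory `m₁ × Fin k`, the pair Φ with the marginal on `m₁ × Fin k`.
  · refine le_iInf fun k => le_iInf fun ρ => ?_
    have hρ := isDensity_submatrix ρ.2 (absorbEquiv m₁ m₂ (Fin k))
    refine (add_le_add (minUncertainty_le_condInfo hΦA hΦB (reduced_isDensity hρ))
      (minUncertainty_le_condInfo hΨA hΨB hρ)).trans ?_
    rw [← EReal.coe_add, EReal.coe_le_coe_iff]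
    exact condInfo_superadditive hΦA hΦB hΨA hΨB ρ.2.1
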